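/- Let $\Omega\subset\mathbb{R}^2$ be a bounded convex domain with smooth boundary and outward unit normal $\mathbf n$, and let $\hat\rho\ge 0$. There is a constant $C=C(\hat\rho,\Omega)>0$ such that the following holds. Let $\rho$ be a measurable function on $\Omega$ with $0\le\rho\le\hat\rho$ almost everywhere, and let $\mathbf u\in H^1(\Omega)=H^1(\Omega;\mathbb{R}^2)$ be a vector field such that $\mathbf u\cdot\mathbf n=0$ on $\partial\Omega$ (in the sense of traces) or $\int_\Omega\mathbf u\,\mathrm d\mathbf x=0$. Then $\sqrt\rho\,\mathbf u\in L^4(\Omega)$ and $$\|\sqrt\rho\,\mathbf u\|_{L^4(\Omega)}^2\le C\left(1+\|\sqrt\rho\,\mathbf u\|_{L^2(\Omega)}\right)\|\nabla\mathbf u\|_{L^2(\Omega)}\sqrt{\ln\left(2+\|\nabla\mathbf u\|_{L^2(\Omega)}^2\right)}.$$ -/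

import Mathlib

open MeasureTheory
open scoped ContDiff

/-- The Euclidean plane. -/
abbrev Plane : Type := EuclideanSpace ℝ (Fin 2)

/-- The boundary of `Ω` is smooth: near each boundary point, `Ω` is the sublevel set `{g < 0}` of a
`C^∞` function `g` whose differential does not vanish at that point. -/
def HasSmoothBoundary (Ω : Set Plane) : Prop :=
  ∀ p ∈ frontier Ω, ∃ (U : Set Plane) (g : Plane → ℝ),
    IsOpen U ∧ p ∈ U ∧ ContDiffOn ℝ ∞ g U ∧ fderiv ℝ g p ≠ 0 ∧ ∀ x ∈ U, (x ∈ Ω ↔ g x < 0)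

/-- A bounded convex planar domain with smooth boundary. -/
structure IsSmoothConvexDomain (Ω : Set Plane) : Prop where
  isOpen : IsOpen Ω
  nonempty : Ω.Nonempty
  bounded : Bornology.IsBounded Ω
  convex : Convex ℝ Ω
  smooth : HasSmoothBoundary Ω

/-- `Du` is the weak gradient of the vector field `u` on `Ω`, where `Du x (i, j)` stands for
`∂ᵢ uʲ`: one has `∫_Ω uʲ ∂ᵢφ = - ∫_Ω (∂ᵢ uʲ) φ` for all test functions `φ ∈ C_c^∞(Ω)`.
The norm of `EuclideanSpace ℝ (Fin 2 × Fin 2)` is the Frobenius norm of the gradient matrix. -/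
def IsWeakGradient (Ω : Set Plane) (u : Plane → Plane)
    (Du : Plane → EuclideanSpace ℝ (Fin 2 × Fin 2)) : Prop :=
  ∀ φ : Plane → ℝ, ContDiff ℝ ∞ φ → HasCompactSupport φ → tsupport φ ⊆ Ω →
    ∀ i j : Fin 2,
      ∫ x in Ω, u x j * fderiv ℝ φ x (EuclideanSpace.single i 1) = - ∫ x in Ω, Du x (i, j) * φ x

/-- `u ∈ H¹(Ω)`, with weak gradient `Du` (which is determined almost everywhere in `Ω`). -/
structure IsH1With (Ω : Set Plane) (u : Plane → Plane)
    (Du : Plane → EuclideanSpace ℝ (Fin 2 × Fin 2)) : Prop where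
  memLp : MemLp u 2 (volume.restrict Ω)
  memLp_grad : MemLp Du 2 (volume.restrict Ω)
  weakGradient : IsWeakGradient Ω u Du

/-- The normal trace of an `H¹` field `u` with weak gradient `Du` vanishes, `u · n = 0` on `∂Ω`, in
the usual sense of Green's formula `∫_Ω (u · ∇φ + φ div u) = ∫_∂Ω φ (u · n)`: the left-hand side
vanishes for every function `φ` that is smooth up to the boundary. -/
def HasZeroNormalTrace (Ω : Set Plane) (u : Plane → Plane)
    (Du : Plane → EuclideanSpace ℝ (Fin 2 × Fin 2)) : Prop :=
  ∀ φ : Plane → ℝ, ContDiff ℝ ∞ φ →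
    ∫ x in Ω, (fderiv ℝ φ x (u x) + φ x * ∑ i : Fin 2, Du x (i, i)) = 0

/-- The norm of `L^p(Ω)` as a real number (for functions in `L^p(Ω)`). -/
noncomputable def normLp {F : Type} [NormedAddCommGroup F] (Ω : Set Plane) (p : ENNReal)
    (f : Plane → F) : ℝ :=
  (eLpNorm f p (volume.restrict Ω)).toReal

/-!
The estimate interpolates `L⁴` between `L²` and `L^p`, and lets `p` grow logarithmically with the
gradient. The core is the critical Sobolev inequality `‖u‖_p ≤ K √p ‖∇u‖_2` with `K` independent of
`p ≥ 4` (`exists_eLpNorm_le_sqrt_mul_eLpNorm_grad`). With `w = √ρ u`, `ε = 2 / (p - 2)` and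
`G = ‖∇u‖_2`, Hölder's inequality gives `‖w‖_4² ≤ ‖w‖_2^(1-ε) ‖w‖_p^(1+ε)`
(`eLpNorm_four_sq_le`), hence at most `‖w‖_2^(1-ε) (L √p G)^(1+ε)`. For `p = 4 + log (2 + G²)` the
surplus factors `(√p)^ε` and `G^ε` are bounded, and `√p` is comparable to `√(log (2 + G²))`
(`interpolation_bound_le`).

The Sobolev inequality rests on convexity. Integrating the gradient along the segments from `x`
bounds `∫_Ω |u(y) - u(x)| dy` by the Riesz potential `∫_Ω |∇u(z)| / |x - z| dz`
(`lintegral_enorm_sub_le_rieszPotential`). Young's inequality (`lintegral_convolution_rpow_le`)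
maps `L²` to `L^p` with the `L^r` norm of the kernel as constant, `1/r = 1/2 + 1/p`; that norm is
computed in polar coordinates and grows like `√p` as `r → 2`
(`lintegral_rieszKernel_rpow_le_sqrt`). For a field that is only weakly differentiable the estimate
is applied to mollifications on the convex sets of points at distance at least `δ` from the
complement, and Fatou's lemma lets `δ → 0` (`lintegral_oscillation_le`).

It remains to control the mean of `u`. If it does not vanish, the normal trace does, and Green's
formula tested with the coordinate functions writes it as an integral of `x ↦ -xⱼ div u`
(`enorm_integral_coord_le`).
-/

open Filter
open scoped ENNReal Convolution Topology

/-! ### Young's inequality -/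

/-- Young's inequality `‖f ∗ k‖_p ≤ ‖f‖_2 ‖k‖_r` with `1 + 1/p = 1/2 + 1/r`, for non-negative
functions. The case `p = 2`, `r = 1` bounds mollification on `L²`; large `p` bounds the Riesz
potential. -/
theorem lintegral_convolution_rpow_le {G : Type*} [AddCommGroup G] [MeasurableSpace G]
    [MeasurableAdd₂ G] [MeasurableNeg G] {μ : Measure G} [SFinite μ]
    [μ.IsAddLeftInvariant] [μ.IsNegInvariant] {f k : G → ℝ≥0∞} (hf : Measurable f)
    (hk : Measurable k) {p : ℝ} (hp : 2 ≤ p) :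
    ∫⁻ x, (∫⁻ y, f y * k (x - y) ∂μ) ^ p ∂μ ≤
      (∫⁻ y, f y ^ (2 : ℝ) ∂μ) ^ (p / 2) *
        (∫⁻ y, k y ^ (2 * p / (p + 2)) ∂μ) ^ (1 + p / 2) := by
  set r : ℝ := 2 * p / (p + 2) with hr
  have hp0 : p ≠ 0 := by positivity
  have hp2 : p + 2 ≠ 0 := by positivity
  set A := ∫⁻ y, f y ^ (2 : ℝ) ∂μ with hA
  set B := ∫⁻ y, k y ^ r ∂μ with hB
  have hkx : ∀ x, Measurable fun y => k (x - y) := fun x =>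
    hk.comp (measurable_const.sub measurable_id)
  have hBx : ∀ x, ∫⁻ y, k (x - y) ^ r ∂μ = B := fun x =>
    lintegral_sub_left_eq_self (fun y => k y ^ r) x
  -- Hölder with exponents `p`, `2p/(p-2)`, `2` applied to `(f²kʳ)^(1/p) (f²)^(1/2-1/p) (kʳ)^(1/2)`
  have holder : ∀ x, ∫⁻ y, f y * k (x - y) ∂μ ≤
      (∫⁻ y, f y ^ (2 : ℝ) * k (x - y) ^ r ∂μ) ^ (1 / p) * A ^ (1 / 2 - 1 / p) *
        B ^ (1 / 2 : ℝ) := by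
    intro x
    have h := ENNReal.lintegral_prod_norm_pow_le (μ := μ) (Finset.univ : Finset (Fin 3))
      (f := ![fun y => f y ^ (2 : ℝ) * k (x - y) ^ r, fun y => f y ^ (2 : ℝ),
        fun y => k (x - y) ^ r])
      (by
        intro i _
        have := hkx x
        fin_cases i <;> simp <;> fun_prop)
      (p := ![1 / p, 1 / 2 - 1 / p, 1 / 2]) (by simp [Fin.sum_univ_three]; ring)
      (by
        intro i _
        have : 1 / p ≤ 1 / 2 := one_div_le_one_div_of_le (by norm_num) hp
        fin_cases i
        · simp; linarith
        · simpa using this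
        · simp)
    simp only [Fin.prod_univ_three] at h
    change ∫⁻ y, (f y ^ (2 : ℝ) * k (x - y) ^ r) ^ (1 / p) * (f y ^ (2 : ℝ)) ^ (1 / 2 - 1 / p) *
      (k (x - y) ^ r) ^ (1 / 2 : ℝ) ∂μ ≤ (∫⁻ y, f y ^ (2 : ℝ) * k (x - y) ^ r ∂μ) ^ (1 / p) *
        A ^ (1 / 2 - 1 / p) * (∫⁻ y, k (x - y) ^ r ∂μ) ^ (1 / 2 : ℝ) at h
    rw [hBx x] at h
    refine le_trans (lintegral_mono fun y => ?_) h
    have h1 : (0 : ℝ) ≤ 1 / p := by positivity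
    have h2 : (0 : ℝ) ≤ 1 / 2 - 1 / p :=
      sub_nonneg.2 (one_div_le_one_div_of_le (by norm_num) hp)
    rw [ENNReal.mul_rpow_of_nonneg _ _ h1]
    have e1 : ((f y ^ (2 : ℝ)) ^ (1 / p)) * ((f y ^ (2 : ℝ)) ^ (1 / 2 - 1 / p)) = f y := by
      rw [← ENNReal.rpow_add_of_nonneg _ _ h1 h2, ← ENNReal.rpow_mul]
      norm_num
    have e2 : ((k (x - y) ^ r) ^ (1 / p)) * ((k (x - y) ^ r) ^ (1 / 2 : ℝ)) = k (x - y) := by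
      rw [← ENNReal.rpow_add_of_nonneg _ _ h1 (by norm_num), ← ENNReal.rpow_mul]
      have : r * (1 / p + 1 / 2) = 1 := by rw [hr]; field_simp; ring
      rw [this, ENNReal.rpow_one]
    refine le_of_eq ?_
    calc f y * k (x - y) = ((f y ^ (2 : ℝ)) ^ (1 / p) * (f y ^ (2 : ℝ)) ^ (1 / 2 - 1 / p)) *
          ((k (x - y) ^ r) ^ (1 / p) * (k (x - y) ^ r) ^ (1 / 2 : ℝ)) := by rw [e1, e2]
      _ = _ := by ring
  have hp0' : (0 : ℝ) ≤ p := by positivity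
  calc ∫⁻ x, (∫⁻ y, f y * k (x - y) ∂μ) ^ p ∂μ
      ≤ ∫⁻ x, (∫⁻ y, f y ^ (2 : ℝ) * k (x - y) ^ r ∂μ) * (A ^ (p / 2 - 1) * B ^ (p / 2)) ∂μ := by
        refine lintegral_mono fun x => ?_
        refine (ENNReal.rpow_le_rpow (holder x) hp0').trans (le_of_eq ?_)
        rw [ENNReal.mul_rpow_of_nonneg _ _ hp0', ENNReal.mul_rpow_of_nonneg _ _ hp0',
          ← ENNReal.rpow_mul, ← ENNReal.rpow_mul, ← ENNReal.rpow_mul, mul_assoc]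
        have e1 : 1 / p * p = 1 := by field_simp
        have e2 : (1 / 2 - 1 / p) * p = p / 2 - 1 := by field_simp
        have e3 : 1 / 2 * p = p / 2 := by ring
        rw [e1, e2, e3, ENNReal.rpow_one]
    _ = (∫⁻ x, ∫⁻ y, f y ^ (2 : ℝ) * k (x - y) ^ r ∂μ ∂μ) * (A ^ (p / 2 - 1) * B ^ (p / 2)) := by
        rw [lintegral_mul_const]
        have : Measurable fun z : G × G => f z.2 ^ (2 : ℝ) * k (z.1 - z.2) ^ r := by fun_prop
        exact this.lintegral_prod_right'
    _ = (A * B) * (A ^ (p / 2 - 1) * B ^ (p / 2)) := by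
        congr 1
        rw [lintegral_lintegral_swap]
        · have : ∀ y, ∫⁻ x, f y ^ (2 : ℝ) * k (x - y) ^ r ∂μ = f y ^ (2 : ℝ) * B := by
            intro y
            rw [lintegral_const_mul _ (by fun_prop),
              lintegral_sub_right_eq_self (fun x => k x ^ r) y]
          simp_rw [this]
          rw [lintegral_mul_const _ (by fun_prop)]
        · have : Measurable fun z : G × G => f z.2 ^ (2 : ℝ) * k (z.1 - z.2) ^ r := by fun_prop
          exact this.aemeasurable
    _ = A ^ (p / 2) * B ^ (1 + p / 2) := by
        have h2 : (0 : ℝ) ≤ p / 2 - 1 := by linarith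
        have e1 : A ^ (p / 2) = A * A ^ (p / 2 - 1) := by
          nth_rw 2 [← ENNReal.rpow_one A]
          rw [← ENNReal.rpow_add_of_nonneg _ _ zero_le_one h2]
          congr 1; ring
        rw [e1, ENNReal.rpow_add_of_nonneg _ _ zero_le_one (by positivity), ENNReal.rpow_one]
        ring

/-! ### The truncated Riesz kernel -/

/-- The Riesz kernel `1 / |z|` of order one in the plane, cut off at distance `d`.
Its value at the origin is `∞`, on a null set. -/
noncomputable def rieszKernel (d : ℝ) : Plane → ℝ≥0∞ :=
  (Metric.ball 0 d).indicator fun z => ‖z‖ₑ⁻¹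

theorem measurable_rieszKernel (d : ℝ) : Measurable (rieszKernel d) :=
  measurable_enorm.inv.indicator Metric.isOpen_ball.measurableSet

theorem lintegral_rieszKernel_rpow {d r : ℝ} (hd : 0 < d) (hr0 : 0 < r) (hr2 : r < 2) :
    ∫⁻ z, rieszKernel d z ^ r = ENNReal.ofReal (2 * Real.pi * d ^ (2 - r) / (2 - r)) := by
  set F : ℝ → ℝ := (Set.Iio d).indicator fun s => s ^ (-r) with hF
  have hint : ∀ s ∈ Set.Ioi (0 : ℝ),
      s ^ (Module.finrank ℝ Plane - 1) • F s = (Set.Ioo 0 d).indicator (fun s => s ^ (1 - r)) s := by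
    intro s hs
    have hs' : 0 < s := hs
    by_cases h : s < d
    · simp only [hF, finrank_euclideanSpace, Fintype.card_fin, Set.indicator, Set.mem_Iio, h,
        Set.mem_Ioo, hs', and_self, if_true, smul_eq_mul]
      norm_num
      rw [sub_eq_add_neg, Real.rpow_add hs', Real.rpow_one]
    · simp [hF, Set.indicator, h]
  have hio : IntegrableOn (fun s : ℝ => s ^ (1 - r)) (Set.Ioo 0 d) := by
    rw [intervalIntegral.integrableOn_Ioo_rpow_iff hd]; linarith
  have hI : Integrable (fun z : Plane => F ‖z‖) := by
    rw [integrable_fun_norm_addHaar, integrableOn_congr_fun hint measurableSet_Ioi]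
    exact ((integrable_indicator_iff measurableSet_Ioo).2 hio).integrableOn
  have hFn : ∀ z : Plane, 0 ≤ F ‖z‖ := fun z =>
    
    Set.indicator_apply_nonneg fun _ => Real.rpow_nonneg (norm_nonneg z) _
  have hae : ∀ᵐ z : Plane, rieszKernel d z ^ r = ENNReal.ofReal (F ‖z‖) := by
    have : ∀ᵐ z : Plane, z ≠ 0 := by simp [ae_iff]
    filter_upwards [this] with z hz
    have hz' : 0 < ‖z‖ := norm_pos_iff.2 hz
    by_cases h : ‖z‖ < d
    · rw [rieszKernel, Set.indicator_of_mem (by simpa using h), hF,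
        Set.indicator_of_mem (by exact h), ← ofReal_norm, ← ENNReal.ofReal_inv_of_pos hz',
        ENNReal.ofReal_rpow_of_pos (inv_pos.2 hz'), Real.rpow_neg hz'.le, Real.inv_rpow hz'.le]
    · rw [rieszKernel, Set.indicator_of_notMem (by simpa using h), hF,
        Set.indicator_of_notMem (by exact h)]
      simp [hr0]
  rw [lintegral_congr_ae hae, ← ofReal_integral_eq_lintegral_ofReal hI (.of_forall hFn),
    integral_fun_norm_addHaar]
  congr 1
  rw [setIntegral_congr_fun measurableSet_Ioi hint, setIntegral_indicator measurableSet_Ioo,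
    Set.inter_eq_right.2 (fun s hs => hs.1), ← integral_Ioc_eq_integral_Ioo,
    ← intervalIntegral.integral_of_le hd.le, integral_rpow (Or.inl (by linarith))]
  have hvol : (volume : Measure Plane).real (Metric.ball 0 1) = Real.pi := by
    simp [Measure.real, EuclideanSpace.volume_ball_fin_two, Real.pi_nonneg]
  rw [hvol, finrank_euclideanSpace, Fintype.card_fin, show 1 - r + 1 = 2 - r by ring,
    Real.zero_rpow (by linarith)]
  simp
  ring

/-! ### Oscillation on convex sets and Riesz potentials -/

theorem lintegral_comp_smul_plane {f : Plane → ℝ≥0∞} (hf : Measurable f) {t : ℝ} (ht : 0 < t) :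
    ∫⁻ w, f (t • w) = ENNReal.ofReal (t ^ (-2 : ℝ)) * ∫⁻ z, f z := by
  rw [← lintegral_map hf (measurable_const_smul t), Measure.map_addHaar_smul volume ht.ne',
    lintegral_smul_measure, finrank_euclideanSpace, Fintype.card_fin,
    abs_of_pos (by positivity), smul_eq_mul, Real.rpow_neg ht.le]
  norm_num

theorem rieszKernel_neg (d : ℝ) (z : Plane) : rieszKernel d (-z) = rieszKernel d z := by
  simp [rieszKernel, Set.indicator]

/-- The fundamental theorem of calculus along a segment, with a majorant `G` of the differential. -/
theorem enorm_sub_le_lintegral_segment {U : Set Plane} (hU : Convex ℝ U) {v : Plane → ℝ}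
    (hv : ContDiff ℝ 1 v) {G : Plane → ℝ≥0∞}
    (hvG : ∀ x ∈ U, ∀ h, ‖fderiv ℝ v x h‖ₑ ≤ G x * ‖h‖ₑ) {x y : Plane} (hx : x ∈ U) (hy : y ∈ U) :
    ‖v y - v x‖ₑ ≤ ∫⁻ t in Set.Ioc (0 : ℝ) 1, U.indicator G (x + t • (y - x)) * ‖y - x‖ₑ := by
  have hd : ∀ t : ℝ, HasDerivAt (fun t : ℝ => v (x + t • (y - x)))
      (fderiv ℝ v (x + t • (y - x)) (y - x)) t := by
    intro t
    have h1 : HasDerivAt (fun t : ℝ => x + t • (y - x)) (y - x) t := by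
      simpa using ((hasDerivAt_id t).smul_const (y - x)).const_add x
    exact ((hv.differentiable one_ne_zero _).hasFDerivAt).comp_hasDerivAt t h1
  have hc : Continuous fun t : ℝ => fderiv ℝ v (x + t • (y - x)) (y - x) :=
    ((hv.continuous_fderiv one_ne_zero).comp (by fun_prop)).clm_apply continuous_const
  have h := intervalIntegral.integral_eq_sub_of_hasDerivAt (a := 0) (b := 1)
    (fun t _ => hd t) (hc.intervalIntegrable _ _)
  simp only [one_smul, zero_smul, add_zero, add_sub_cancel] at h
  rw [← h, intervalIntegral.integral_of_le zero_le_one]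
  refine (enorm_integral_le_lintegral_enorm _).trans
    (setLIntegral_mono' measurableSet_Ioc fun t ht => ?_)
  have hm : x + t • (y - x) ∈ U := hU.add_smul_sub_mem hx hy ⟨ht.1.le, ht.2⟩
  rw [Set.indicator_of_mem hm]
  exact hvG _ hm _

theorem lintegral_Ioi_rpow_neg_three {a : ℝ} (ha : 0 < a) :
    ∫⁻ t in Set.Ioi a, ENNReal.ofReal (t ^ (-3 : ℝ)) = ENNReal.ofReal (a ^ (-2 : ℝ) / 2) := by
  rw [← ofReal_integral_eq_lintegral_ofReal (integrableOn_Ioi_rpow_of_lt (by norm_num) ha),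
    integral_Ioi_rpow_of_lt (by norm_num) ha]
  · congr 1; norm_num
  · exact (ae_restrict_mem measurableSet_Ioi).mono fun t ht =>
      Real.rpow_nonneg (ha.trans ht).le _

/-- The inner integral, over the position `t` on the segment, after the substitution
`z = x + t (y - x)`: the Jacobian `t⁻²` and the length `|z| / t` integrate over `t > |z| / d`
to a multiple of the Riesz kernel. -/
theorem lintegral_dilate_le_rieszKernel {d : ℝ} (hd : 0 < d) (z : Plane) :
    ∫⁻ t in Set.Ioc (0 : ℝ) 1, ENNReal.ofReal (t ^ (-2 : ℝ)) *
        (Metric.ball (0 : Plane) d).indicator (fun w => ‖w‖ₑ) (t⁻¹ • z) ≤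
      ENNReal.ofReal (d ^ 2 / 2) * rieszKernel d z := by
  rcases eq_or_ne z 0 with rfl | hz
  · simp [Set.indicator]
  have hz' : 0 < ‖z‖ := norm_pos_iff.2 hz
  by_cases hzd : ‖z‖ < d
  · rw [rieszKernel, Set.indicator_of_mem (by simpa using hzd)]
    calc _ ≤ ∫⁻ t in Set.Ioc (0 : ℝ) 1, (Set.Ioi (‖z‖ / d)).indicator
            (fun t => ‖z‖ₑ * ENNReal.ofReal (t ^ (-3 : ℝ))) t := by
          refine setLIntegral_mono' measurableSet_Ioc fun t ht => ?_
          have ht0 : 0 < t := ht.1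
          have hn : ‖t⁻¹ • z‖ = t⁻¹ * ‖z‖ := by
            rw [norm_smul, Real.norm_of_nonneg (inv_nonneg.2 ht0.le)]
          by_cases h : ‖z‖ / d < t
          · rw [Set.indicator_of_mem (s := Set.Ioi (‖z‖ / d)) h]
            refine (mul_le_mul_right (Set.indicator_le_self _ _ _) _).trans (le_of_eq ?_)
            rw [← ofReal_norm, ← ofReal_norm, hn, ← ENNReal.ofReal_mul (by positivity),
              ← ENNReal.ofReal_mul (by positivity)]
            congr 1
            rw [show (-3 : ℝ) = -2 + -1 by norm_num, Real.rpow_add ht0, Real.rpow_neg_one]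
            ring
          · rw [Set.indicator_of_notMem (s := Set.Ioi (‖z‖ / d)) h, Set.indicator_of_notMem]
            · simp
            · rw [mem_ball_zero_iff, hn, not_lt]
              rw [not_lt, le_div_iff₀ hd] at h
              rw [inv_mul_eq_div, le_div_iff₀ ht0]
              linarith
      _ ≤ ∫⁻ t, (Set.Ioi (‖z‖ / d)).indicator
            (fun t => ‖z‖ₑ * ENNReal.ofReal (t ^ (-3 : ℝ))) t := setLIntegral_le_lintegral _ _
      _ = ‖z‖ₑ * ENNReal.ofReal ((‖z‖ / d) ^ (-2 : ℝ) / 2) := by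
          rw [lintegral_indicator measurableSet_Ioi, lintegral_const_mul _ (by fun_prop),
            lintegral_Ioi_rpow_neg_three (by positivity)]
      _ = ENNReal.ofReal (d ^ 2 / 2) * ‖z‖ₑ⁻¹ := by
          rw [← ofReal_norm, ← ENNReal.ofReal_inv_of_pos hz', ← ENNReal.ofReal_mul hz'.le,
            ← ENNReal.ofReal_mul (by positivity)]
          congr 1
          rw [Real.rpow_neg (by positivity)]
          norm_num
          field_simp
  · refine le_of_eq_of_le ?_ zero_le
    rw [setLIntegral_congr_fun (g := fun _ => 0) measurableSet_Ioc, lintegral_zero]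
    intro t ht
    have ht0 : 0 < t := ht.1
    simp only
    rw [Set.indicator_of_notMem, mul_zero]
    rw [mem_ball_zero_iff, norm_smul, Real.norm_of_nonneg (inv_nonneg.2 ht0.le), not_lt,
      inv_mul_eq_div, le_div_iff₀ ht0]
    nlinarith [ht.2]

/-- On a convex set, the mean oscillation of a function about its value at `x` is bounded by the
Riesz potential of its gradient at `x`: integrate over `y` the gradient along the segment from `x`
to `y`, and substitute `z = x + t (y - x)`. -/
theorem lintegral_enorm_sub_le_rieszPotential {U : Set Plane} (hU : Convex ℝ U)
    (hUm : MeasurableSet U) {d : ℝ} (hd : 0 < d) (hUd : ∀ x ∈ U, ∀ y ∈ U, dist x y < d)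
    {v : Plane → ℝ} (hv : ContDiff ℝ 1 v) {G : Plane → ℝ≥0∞} (hG : Measurable G)
    (hvG : ∀ x ∈ U, ∀ h, ‖fderiv ℝ v x h‖ₑ ≤ G x * ‖h‖ₑ) {x : Plane} (hx : x ∈ U) :
    ∫⁻ y in U, ‖v y - v x‖ₑ ≤ ENNReal.ofReal (d ^ 2 / 2) *
      ∫⁻ z, U.indicator G z * rieszKernel d (x - z) := by
  set H := U.indicator G with hH
  have hHm : Measurable H := hG.indicator hUm
  set N : Plane → ℝ≥0∞ := (Metric.ball (0 : Plane) d).indicator fun w => ‖w‖ₑ with hN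
  have hNm : Measurable N := measurable_enorm.indicator Metric.isOpen_ball.measurableSet
  calc ∫⁻ y in U, ‖v y - v x‖ₑ
      ≤ ∫⁻ y in U, ∫⁻ t in Set.Ioc (0 : ℝ) 1, H (x + t • (y - x)) * N (y - x) := by
        refine setLIntegral_mono' hUm fun y hy => ?_
        have hyx : y - x ∈ Metric.ball (0 : Plane) d := by
          rw [mem_ball_zero_iff, ← dist_eq_norm]; exact hUd y hy x hx
        rw [hN, Set.indicator_of_mem hyx]
        exact enorm_sub_le_lintegral_segment hU hv hvG hx hy
    _ ≤ ∫⁻ y, ∫⁻ t in Set.Ioc (0 : ℝ) 1, H (x + t • (y - x)) * N (y - x) :=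
        setLIntegral_le_lintegral _ _
    _ = ∫⁻ w, ∫⁻ t in Set.Ioc (0 : ℝ) 1, H (x + t • w) * N w :=
        lintegral_sub_right_eq_self
          (fun w => ∫⁻ t in Set.Ioc (0 : ℝ) 1, H (x + t • w) * N w) x
    _ = ∫⁻ t in Set.Ioc (0 : ℝ) 1, ∫⁻ w, H (x + t • w) * N w := by
        rw [lintegral_lintegral_swap]
        have : Measurable fun q : Plane × ℝ => H (x + q.2 • q.1) * N q.1 := by fun_prop
        exact this.aemeasurable
    _ = ∫⁻ t in Set.Ioc (0 : ℝ) 1, ∫⁻ z, H (x + z) *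
          (ENNReal.ofReal (t ^ (-2 : ℝ)) * N (t⁻¹ • z)) := by
        refine setLIntegral_congr_fun measurableSet_Ioc fun t ht => ?_
        have h := lintegral_comp_smul_plane (f := fun z => H (x + z) * N (t⁻¹ • z))
          (by fun_prop) ht.1
        simp only [smul_smul, inv_mul_cancel₀ ht.1.ne', one_smul] at h
        rw [h, ← lintegral_const_mul _ (by fun_prop)]
        exact lintegral_congr fun z => by ring
    _ = ∫⁻ z, ∫⁻ t in Set.Ioc (0 : ℝ) 1, H (x + z) *
          (ENNReal.ofReal (t ^ (-2 : ℝ)) * N (t⁻¹ • z)) := by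
        rw [lintegral_lintegral_swap]
        have : Measurable fun q : ℝ × Plane => H (x + q.2) *
          (ENNReal.ofReal (q.1 ^ (-2 : ℝ)) * N (q.1⁻¹ • q.2)) := by fun_prop
        exact this.aemeasurable
    _ ≤ ∫⁻ z, H (x + z) * (ENNReal.ofReal (d ^ 2 / 2) * rieszKernel d z) := by
        refine lintegral_mono fun z => ?_
        rw [lintegral_const_mul _ (by fun_prop)]
        exact mul_le_mul_right (lintegral_dilate_le_rieszKernel hd z) _
    _ = ENNReal.ofReal (d ^ 2 / 2) * ∫⁻ z, H (x + z) * rieszKernel d z := by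
        have := measurable_rieszKernel d
        rw [← lintegral_const_mul _ (by fun_prop)]
        exact lintegral_congr fun z => by ring
    _ = ENNReal.ofReal (d ^ 2 / 2) * ∫⁻ z, H z * rieszKernel d (x - z) := by
        congr 1
        rw [← lintegral_add_left_eq_self (fun z => H z * rieszKernel d (x - z)) x]
        refine lintegral_congr fun z => ?_
        rw [show x - (x + z) = -z by abel, rieszKernel_neg]

/-! ### Mollification of weakly differentiable functions -/

/-- `D 0, D 1` are the weak partial derivatives of the scalar function `w` on `Ω`. -/
def IsWeakGradientScalar (Ω : Set Plane) (w : Plane → ℝ) (D : Fin 2 → Plane → ℝ) : Prop :=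
  ∀ φ : Plane → ℝ, ContDiff ℝ ∞ φ → HasCompactSupport φ → tsupport φ ⊆ Ω →
    ∀ i : Fin 2,
      ∫ x in Ω, w x * fderiv ℝ φ x (EuclideanSpace.single i 1) = - ∫ x in Ω, D i x * φ x

/-- The mollification of `w`, extended by zero outside `Ω`, by a bump function `φ`. -/
noncomputable def mollify (φ : ContDiffBump (0 : Plane)) (Ω : Set Plane) (w : Plane → ℝ) :
    Plane → ℝ :=
  φ.normed volume ⋆[ContinuousLinearMap.lsmul ℝ ℝ, volume] Ω.indicator w

theorem contDiff_mollify (φ : ContDiffBump (0 : Plane)) {Ω : Set Plane} {w : Plane → ℝ}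
    (hw : Integrable (Ω.indicator w)) : ContDiff ℝ ∞ (mollify φ Ω w) :=
  φ.hasCompactSupport_normed.contDiff_convolution_left _ φ.contDiff_normed hw.locallyIntegrable

theorem fderiv_mollify_apply (φ : ContDiffBump (0 : Plane)) {Ω : Set Plane} {w : Plane → ℝ}
    (hΩ : MeasurableSet Ω) (hw : Integrable (Ω.indicator w)) (x h : Plane) :
    fderiv ℝ (mollify φ Ω w) x h = ∫ y in Ω, w y * fderiv ℝ (φ.normed volume) (x - y) h := by
  have hφ : ContDiff ℝ 1 (φ.normed volume) := φ.contDiff_normed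
  have h1 := φ.hasCompactSupport_normed.hasFDerivAt_convolution_left
    (ContinuousLinearMap.lsmul ℝ ℝ) hφ hw.locallyIntegrable x (μ := volume)
  have h2 := (φ.hasCompactSupport_normed.fderiv ℝ).convolutionExists_left
    (ContinuousLinearMap.precompL Plane (ContinuousLinearMap.lsmul ℝ ℝ))
    (hφ.continuous_fderiv one_ne_zero) hw.locallyIntegrable x
  have h3 := h2.integrable_swap
  rw [mollify, h1.fderiv, convolution_eq_swap, ContinuousLinearMap.integral_apply h3,
    ← integral_indicator hΩ]
  refine integral_congr_ae (.of_forall fun y => ?_)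
  by_cases hy : y ∈ Ω <;> simp [hy, mul_comm]

theorem fderiv_mollify_single (φ : ContDiffBump (0 : Plane)) {Ω : Set Plane} {w : Plane → ℝ}
    {D : Fin 2 → Plane → ℝ} (hΩ : MeasurableSet Ω) (hw : Integrable (Ω.indicator w))
    (hD : IsWeakGradientScalar Ω w D) {x : Plane} (hx : Metric.closedBall x φ.rOut ⊆ Ω)
    (i : Fin 2) :
    fderiv ℝ (mollify φ Ω w) x (EuclideanSpace.single i 1) =
      ∫ y in Ω, D i y * φ.normed volume (x - y) := by
  have hφ : ContDiff ℝ ∞ (φ.normed (volume : Measure Plane)) := φ.contDiff_normed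
  have hts : tsupport (fun y => φ.normed volume (x - y)) ⊆ Metric.closedBall x φ.rOut := by
    refine closure_minimal (fun y hy => ?_) Metric.isClosed_closedBall
    have : x - y ∈ tsupport (φ.normed (volume : Measure Plane)) := subset_tsupport _ hy
    rw [φ.tsupport_normed_eq, mem_closedBall_zero_iff] at this
    rwa [mem_closedBall_iff_norm']
  have h := hD (fun y => φ.normed volume (x - y)) (hφ.comp (contDiff_const.sub contDiff_id))
    (HasCompactSupport.of_support_subset_isCompact (isCompact_closedBall x φ.rOut)
      ((subset_tsupport _).trans hts)) (hts.trans hx) i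
  have hd : ∀ y, fderiv ℝ (fun y => φ.normed volume (x - y)) y (EuclideanSpace.single i 1) =
      - fderiv ℝ (φ.normed volume) (x - y) (EuclideanSpace.single i 1) := by
    intro y
    have h1 : HasFDerivAt (fun y : Plane => x - y) (-(ContinuousLinearMap.id ℝ Plane)) y := by
      simpa using (hasFDerivAt_id y).const_sub x
    have h2 := ((hφ.differentiable (by simp)) (x - y)).hasFDerivAt.comp y h1
    rw [show (fun y => φ.normed volume (x - y)) = φ.normed volume ∘ fun y => x - y from rfl,
      h2.fderiv]
    simp
  simp only [hd, mul_neg, integral_neg, neg_inj] at h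
  rw [fderiv_mollify_apply φ hΩ hw, h]

/-- In the interior of `Ω`, the gradient of a mollification is bounded by the mollification of any
majorant `g` of the weak derivatives. -/
theorem enorm_fderiv_mollify_le (φ : ContDiffBump (0 : Plane)) {Ω : Set Plane} {w : Plane → ℝ}
    {D : Fin 2 → Plane → ℝ} (hΩ : MeasurableSet Ω) (hw : Integrable (Ω.indicator w))
    (hD : IsWeakGradientScalar Ω w D) {g : Plane → ℝ≥0∞}
    (hg : ∀ i, ∀ᵐ y ∂volume.restrict Ω, ‖D i y‖ₑ ≤ g y) {x : Plane}
    (hx : Metric.closedBall x φ.rOut ⊆ Ω) (h : Plane) :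
    ‖fderiv ℝ (mollify φ Ω w) x h‖ₑ ≤
      2 * (∫⁻ y, g y * ‖φ.normed volume (x - y)‖ₑ) * ‖h‖ₑ := by
  set L := fderiv ℝ (mollify φ Ω w) x with hL
  have hi : ∀ i : Fin 2, ‖L (EuclideanSpace.single i 1)‖ₑ ≤
      ∫⁻ y, g y * ‖φ.normed volume (x - y)‖ₑ := by
    intro i
    rw [hL, fderiv_mollify_single φ hΩ hw hD hx i]
    refine (enorm_integral_le_lintegral_enorm _).trans ?_
    refine (lintegral_mono_ae ?_).trans (setLIntegral_le_lintegral Ω _)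
    filter_upwards [hg i] with y hy
    rw [enorm_mul]
    gcongr
  have hh : h = h 0 • EuclideanSpace.single 0 (1 : ℝ) + h 1 • EuclideanSpace.single 1 (1 : ℝ) := by
    ext j; fin_cases j <;> simp
  have hc : ∀ i : Fin 2, ‖h i‖ₑ ≤ ‖h‖ₑ := fun i => by
    rw [enorm_le_iff_norm_le]; exact PiLp.norm_apply_le h i
  calc ‖L h‖ₑ = ‖h 0 * L (EuclideanSpace.single 0 1) + h 1 * L (EuclideanSpace.single 1 1)‖ₑ := by
        conv_lhs => rw [hh, map_add, map_smul, map_smul, smul_eq_mul, smul_eq_mul]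
    _ ≤ ‖h 0‖ₑ * ‖L (EuclideanSpace.single 0 1)‖ₑ + ‖h 1‖ₑ * ‖L (EuclideanSpace.single 1 1)‖ₑ := by
        refine (enorm_add_le _ _).trans_eq ?_
        rw [enorm_mul, enorm_mul]
    _ ≤ ‖h‖ₑ * (∫⁻ y, g y * ‖φ.normed volume (x - y)‖ₑ) +
          ‖h‖ₑ * (∫⁻ y, g y * ‖φ.normed volume (x - y)‖ₑ) := by
        gcongr <;> first | exact hc _ | exact hi _
    _ = _ := by ring

/-! ### Inner sets and passage to the limit -/

/-- The points of `Ω` at distance at least `δ` from the complement. -/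
def innerSet (Ω : Set Plane) (δ : ℝ) : Set Plane := (Metric.thickening δ Ωᶜ)ᶜ

theorem mem_innerSet {Ω : Set Plane} {δ : ℝ} {x : Plane} :
    x ∈ innerSet Ω δ ↔ Metric.ball x δ ⊆ Ω := by
  rw [innerSet, Set.mem_compl_iff, Metric.mem_thickening_iff]
  push Not
  constructor
  · intro h y hy
    by_contra hyΩ
    exact absurd (h y hyΩ) (not_le.2 (Metric.mem_ball'.1 hy))
  · intro h y hy
    by_contra! hlt
    exact hy (h (Metric.mem_ball'.2 hlt))

theorem convex_innerSet {Ω : Set Plane} (hΩ : Convex ℝ Ω) (δ : ℝ) : Convex ℝ (innerSet Ω δ) := by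
  intro x hx y hy a b ha hb hab
  rw [mem_innerSet] at hx hy ⊢
  intro z hz
  set e := z - (a • x + b • y) with he
  have hz' : ‖e‖ < δ := mem_ball_iff_norm.1 hz
  have h1 : x + e ∈ Ω := hx (by simpa [mem_ball_iff_norm] using hz')
  have h2 : y + e ∈ Ω := hy (by simpa [mem_ball_iff_norm] using hz')
  have h3 : z = a • (x + e) + b • (y + e) := by
    rw [smul_add, smul_add, add_add_add_comm, ← add_smul, hab, one_smul, he]
    abel
  rw [h3]
  exact hΩ h1 h2 ha hb hab

theorem measurableSet_innerSet (Ω : Set Plane) (δ : ℝ) : MeasurableSet (innerSet Ω δ) :=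
  Metric.isOpen_thickening.measurableSet.compl

/-- The oscillation estimate `‖∫_U |v(y) - v(·)| dy‖_p ≤ d² ‖g‖_2 ‖1/|·|‖_r` for a mollification `v`
of a function with weak gradient dominated by `g`. -/
theorem lintegral_oscillation_mollify_le {Ω : Set Plane} (hΩ : MeasurableSet Ω)
    (hconv : Convex ℝ Ω) {d : ℝ} (hd : 0 < d) (hdist : ∀ x ∈ Ω, ∀ y ∈ Ω, dist x y < d)
    {w : Plane → ℝ} (hw : Integrable (Ω.indicator w)) {D : Fin 2 → Plane → ℝ}
    (hD : IsWeakGradientScalar Ω w D) {g : Plane → ℝ≥0∞} (hgm : Measurable g)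
    (hg : ∀ i, ∀ᵐ y ∂volume.restrict Ω, ‖D i y‖ₑ ≤ g y) {p : ℝ} (hp : 2 ≤ p)
    (φ : ContDiffBump (0 : Plane)) {δ : ℝ} (hδ : φ.rOut < δ) :
    ∫⁻ x in innerSet Ω δ, (∫⁻ y in innerSet Ω δ, ‖mollify φ Ω w y - mollify φ Ω w x‖ₑ) ^ p ≤
      ENNReal.ofReal (d ^ 2) ^ p * ((∫⁻ z, g z ^ (2 : ℝ)) ^ (p / 2) *
        (∫⁻ z, rieszKernel d z ^ (2 * p / (p + 2))) ^ (1 + p / 2)) := by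
  set U := innerSet Ω δ with hU
  set v := mollify φ Ω w with hv
  set k : Plane → ℝ≥0∞ := fun z => ‖φ.normed volume z‖ₑ with hk
  have hkm : Measurable k := (φ.continuous_normed (μ := volume)).measurable.enorm
  set M : Plane → ℝ≥0∞ := fun x => ∫⁻ y, g y * k (x - y) with hM
  have hMm : Measurable M := by
    have : Measurable fun q : Plane × Plane => g q.2 * k (q.1 - q.2) := by fun_prop
    exact this.lintegral_prod_right'
  have hball : ∀ x ∈ U, Metric.closedBall x φ.rOut ⊆ Ω := fun x hx =>
    (Metric.closedBall_subset_ball hδ).trans (mem_innerSet.1 hx)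
  have hUΩ : U ⊆ Ω := fun x hx => hball x hx (Metric.mem_closedBall_self φ.rOut_pos.le)
  have hvU : ∀ x ∈ U, ∀ h, ‖fderiv ℝ v x h‖ₑ ≤ (2 * M x) * ‖h‖ₑ := fun x hx h =>
    enorm_fderiv_mollify_le φ hΩ hw hD hg (hball x hx) h
  have hv1 : ContDiff ℝ 1 v := (contDiff_mollify φ hw).of_le (by simp)
  have hp0 : 0 ≤ p := by linarith
  have hkint : ∫⁻ y, k y = 1 := by
    have h1 : ∀ y, k y = ENNReal.ofReal (φ.normed volume y) := fun y =>
      Real.enorm_of_nonneg (φ.nonneg_normed y)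
    simp_rw [h1]
    rw [← ofReal_integral_eq_lintegral_ofReal φ.integrable_normed
      (.of_forall fun y => φ.nonneg_normed y), φ.integral_normed, ENNReal.ofReal_one]
  -- mollification contracts `L²`: Young's inequality with `p = 2`, `r = 1`
  have hM2 : ∫⁻ x, M x ^ (2 : ℝ) ≤ ∫⁻ z, g z ^ (2 : ℝ) := by
    have h := lintegral_convolution_rpow_le (μ := (volume : Measure Plane)) hgm hkm le_rfl
    norm_num [hkint] at h
    simpa [hM] using h
  calc ∫⁻ x in U, (∫⁻ y in U, ‖v y - v x‖ₑ) ^ p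
      ≤ ∫⁻ x in U, ENNReal.ofReal (d ^ 2) ^ p * (∫⁻ z, M z * rieszKernel d (x - z)) ^ p := by
        refine setLIntegral_mono' (measurableSet_innerSet Ω δ) fun x hx => ?_
        rw [← ENNReal.mul_rpow_of_nonneg _ _ hp0]
        refine ENNReal.rpow_le_rpow ?_ hp0
        refine (lintegral_enorm_sub_le_rieszPotential (convex_innerSet hconv δ)
          (measurableSet_innerSet Ω δ) hd (fun x hx y hy => hdist x (hUΩ hx) y (hUΩ hy)) hv1
          (hMm.const_mul 2) hvU hx).trans ?_
        have h2 : ENNReal.ofReal (d ^ 2) = ENNReal.ofReal (d ^ 2 / 2) * 2 := by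
          rw [show (2 : ℝ≥0∞) = ENNReal.ofReal 2 by simp, ← ENNReal.ofReal_mul (by positivity)]
          congr 1; ring
        rw [h2, mul_assoc]
        have hrm := measurable_rieszKernel d
        refine mul_le_mul_right ?_ _
        rw [← lintegral_const_mul _ (by fun_prop)]
        refine lintegral_mono fun z => ?_
        rw [← mul_assoc]
        exact mul_le_mul_left (Set.indicator_le_self _ _ _) _
    _ ≤ ∫⁻ x, ENNReal.ofReal (d ^ 2) ^ p * (∫⁻ z, M z * rieszKernel d (x - z)) ^ p :=
        setLIntegral_le_lintegral _ _
    _ = ENNReal.ofReal (d ^ 2) ^ p * ∫⁻ x, (∫⁻ z, M z * rieszKernel d (x - z)) ^ p := by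
        have hrm := measurable_rieszKernel d
        have : Measurable fun q : Plane × Plane => M q.2 * rieszKernel d (q.1 - q.2) := by fun_prop
        exact lintegral_const_mul _ (this.lintegral_prod_right'.pow_const p)
    _ ≤ _ := by
        refine mul_le_mul_right ((lintegral_convolution_rpow_le hMm (measurable_rieszKernel d)
          hp).trans ?_) _
        gcongr

/-- The oscillation estimate `‖∫_Ω |w(y) - w(·)| dy‖_p ≤ d² ‖∇w‖_2 ‖1/|·|‖_r` for a Sobolev function
on a bounded convex open set: Fatou's lemma along mollifications on inner sets exhausting `Ω`. -/
theorem lintegral_oscillation_le {Ω : Set Plane} (hΩ : IsOpen Ω)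
    (hconv : Convex ℝ Ω) {d : ℝ} (hd : 0 < d) (hdist : ∀ x ∈ Ω, ∀ y ∈ Ω, dist x y < d)
    {w : Plane → ℝ} (hw : IntegrableOn w Ω) {D : Fin 2 → Plane → ℝ}
    (hD : IsWeakGradientScalar Ω w D) {g : Plane → ℝ≥0∞} (hgm : Measurable g)
    (hg : ∀ i, ∀ᵐ y ∂volume.restrict Ω, ‖D i y‖ₑ ≤ g y) {p : ℝ} (hp : 2 ≤ p) :
    ∫⁻ x in Ω, (∫⁻ y in Ω, ‖w y - w x‖ₑ) ^ p ≤
      ENNReal.ofReal (d ^ 2) ^ p * ((∫⁻ z, g z ^ (2 : ℝ)) ^ (p / 2) *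
        (∫⁻ z, rieszKernel d z ^ (2 * p / (p + 2))) ^ (1 + p / 2)) := by
  have hw' : Integrable (Ω.indicator w) := (integrable_indicator_iff hΩ.measurableSet).2 hw
  have hp0 : 0 < p := by linarith
  have hδ : ∀ n : ℕ, (0 : ℝ) < 1 / ((n : ℝ) + 1) := fun n => by positivity
  let φ : ℕ → ContDiffBump (0 : Plane) := fun n =>
    ⟨1 / ((n : ℝ) + 1) / 4, 1 / ((n : ℝ) + 1) / 2, by have := hδ n; positivity, by
      have := hδ n; linarith⟩
  set v : ℕ → Plane → ℝ := fun n => mollify (φ n) Ω w with hv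
  set U : ℕ → Set Plane := fun n => innerSet Ω (1 / ((n : ℝ) + 1)) with hU
  have hUm : ∀ n, MeasurableSet (U n) := fun n => measurableSet_innerSet _ _
  have hvc : ∀ n, Continuous (v n) := fun n => (contDiff_mollify (φ n) hw').continuous
  have hUΩ : ∀ n, U n ⊆ Ω := fun n x hx => mem_innerSet.1 hx (Metric.mem_ball_self (hδ n))
  have hlim0 : Tendsto (fun n : ℕ => 1 / ((n : ℝ) + 1)) atTop (𝓝 0) :=
    tendsto_one_div_add_atTop_nhds_zero_nat
  have hUev : ∀ x ∈ Ω, ∀ᶠ n in atTop, x ∈ U n := by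
    intro x hx
    obtain ⟨ε, hε, hball⟩ := Metric.isOpen_iff.1 hΩ x hx
    filter_upwards [hlim0.eventually_lt_const hε] with n hn
    exact mem_innerSet.2 ((Metric.ball_subset_ball hn.le).trans hball)
  have hconvg : ∀ᵐ x ∂volume.restrict Ω, Tendsto (fun n => v n x) atTop (𝓝 (w x)) := by
    have h := ContDiffBump.ae_convolution_tendsto_right_of_locallyIntegrable (φ := φ) (l := atTop)
      (K := 2) (μ := volume) (g := Ω.indicator w)
      (by simpa [φ] using hlim0.div_const 2)
      (.of_forall fun n => by simp only [φ]; linarith) hw'.locallyIntegrable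
    filter_upwards [ae_restrict_of_ae h, ae_restrict_mem hΩ.measurableSet] with x hx hxΩ
    rwa [Set.indicator_of_mem hxΩ] at hx
  set F : ℕ → Plane → ℝ≥0∞ := fun n x => ∫⁻ y in U n, ‖v n y - v n x‖ₑ with hF
  have hFm : ∀ n, Measurable (F n) := by
    intro n
    have hc := hvc n
    have : Measurable fun q : Plane × Plane => ‖v n q.2 - v n q.1‖ₑ := by fun_prop
    exact this.lintegral_prod_right'
  have inner : ∀ᵐ x ∂volume.restrict Ω,
      ∫⁻ y in Ω, ‖w y - w x‖ₑ ≤ liminf (fun n => F n x) atTop := by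
    filter_upwards [hconvg] with x hx
    calc ∫⁻ y in Ω, ‖w y - w x‖ₑ
        ≤ ∫⁻ y in Ω, liminf (fun n => (U n).indicator (fun y => ‖v n y - v n x‖ₑ) y) atTop := by
          refine lintegral_mono_ae ?_
          filter_upwards [hconvg, ae_restrict_mem hΩ.measurableSet] with y hy hyΩ
          refine le_of_eq (Tendsto.liminf_eq ?_).symm
          refine ((hy.sub hx).enorm).congr' ?_
          filter_upwards [hUev y hyΩ] with n hn
          rw [Set.indicator_of_mem hn]
      _ ≤ liminf (fun n => ∫⁻ y in Ω, (U n).indicator (fun y => ‖v n y - v n x‖ₑ) y) atTop := by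
          refine lintegral_liminf_le fun n => ?_
          have hc := hvc n
          exact Measurable.indicator (by fun_prop) (hUm n)
      _ = liminf (fun n => F n x) atTop := by
          congr 1
          funext n
          rw [lintegral_indicator (hUm n), Measure.restrict_restrict (hUm n),
            Set.inter_eq_left.2 (hUΩ n)]
  set B := ENNReal.ofReal (d ^ 2) ^ p * ((∫⁻ z, g z ^ (2 : ℝ)) ^ (p / 2) *
        (∫⁻ z, rieszKernel d z ^ (2 * p / (p + 2))) ^ (1 + p / 2)) with hB
  calc ∫⁻ x in Ω, (∫⁻ y in Ω, ‖w y - w x‖ₑ) ^ p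
      ≤ ∫⁻ x in Ω, liminf (fun n => (U n).indicator (fun x => F n x ^ p) x) atTop := by
        refine lintegral_mono_ae ?_
        filter_upwards [inner, ae_restrict_mem hΩ.measurableSet] with x hx hxΩ
        refine (ENNReal.rpow_le_rpow hx hp0.le).trans (le_of_eq ?_)
        have h1 := (ENNReal.monotone_rpow_of_nonneg hp0.le).map_liminf_of_continuousAt
          (F := atTop) (fun n => F n x) (ENNReal.continuous_rpow_const.continuousAt)
        rw [h1]
        refine liminf_congr ?_
        filter_upwards [hUev x hxΩ] with n hn
        rw [Set.indicator_of_mem hn]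
        rfl
    _ ≤ liminf (fun n => ∫⁻ x in Ω, (U n).indicator (fun x => F n x ^ p) x) atTop :=
        lintegral_liminf_le fun n => ((hFm n).pow_const p).indicator (hUm n)
    _ ≤ B := by
        refine liminf_le_of_le (by isBoundedDefault) fun b hb => ?_
        obtain ⟨n, hn⟩ := hb.exists
        refine hn.trans ?_
        rw [lintegral_indicator (hUm n), Measure.restrict_restrict (hUm n),
          Set.inter_eq_left.2 (hUΩ n)]
        exact lintegral_oscillation_mollify_le hΩ.measurableSet hconv hd hdist hw' hD hgm hg hp
          (φ n) (by have := hδ n; simp only [φ]; linarith)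

/-! ### The critical Sobolev inequality -/

theorem rpow_one_div_self_le_exp_one {p : ℝ} (hp : 0 < p) : p ^ (1 / p) ≤ Real.exp 1 := by
  rw [Real.rpow_def_of_pos hp]
  refine Real.exp_le_exp.2 ?_
  rw [mul_one_div, div_le_one hp]
  exact (Real.log_le_sub_one_of_pos hp).trans (by linarith)

/-- The `L^r` norm of the Riesz kernel, `1/r = 1/2 + 1/p`, grows like `√p`: this is the origin of
the square root of the logarithm in the final estimate. -/
theorem lintegral_rieszKernel_rpow_le_sqrt {d p : ℝ} (hd : 1 ≤ d) (hp : 4 ≤ p) :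
    (∫⁻ z, rieszKernel d z ^ (2 * p / (p + 2))) ^ (1 / p + 1 / 2) ≤
      ENNReal.ofReal (2 * Real.pi * d ^ 2 * Real.exp 1 * √p) := by
  have hp0 : 0 < p := by linarith
  have h2r : 2 - 2 * p / (p + 2) = 4 / (p + 2) := by field_simp; ring
  have hQ : 1 ≤ 2 * Real.pi * d ^ 2 := by
    nlinarith [Real.pi_gt_three, one_le_pow₀ (n := 2) hd]
  rw [lintegral_rieszKernel_rpow (by linarith) (by positivity)
    (by rw [div_lt_iff₀ (by linarith)]; linarith), h2r,
    ENNReal.ofReal_rpow_of_nonneg (by positivity) (by positivity)]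
  refine ENNReal.ofReal_le_ofReal ?_
  have hd2 : d ^ (4 / (p + 2)) ≤ d ^ 2 := by
    rw [← Real.rpow_natCast d 2]
    refine Real.rpow_le_rpow_of_exponent_le hd ?_
    rw [div_le_iff₀ (by linarith)]
    norm_num
    linarith
  have h1 : 2 * Real.pi * d ^ (4 / (p + 2)) / (4 / (p + 2)) ≤ 2 * Real.pi * d ^ 2 * p := by
    rw [div_div_eq_mul_div, div_le_iff₀ (by norm_num), mul_assoc _ p]
    have := Real.pi_pos
    gcongr
    linarith
  have hle : 1 / p ≤ 1 / 4 := one_div_le_one_div_of_le (by norm_num) hp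
  calc (2 * Real.pi * d ^ (4 / (p + 2)) / (4 / (p + 2))) ^ (1 / p + 1 / 2)
      ≤ (2 * Real.pi * d ^ 2 * p) ^ (1 / p + 1 / 2) := by gcongr
    _ = (2 * Real.pi * d ^ 2) ^ (1 / p + 1 / 2) * (p ^ (1 / p) * √p) := by
        rw [Real.mul_rpow (by positivity) hp0.le, Real.rpow_add hp0, Real.sqrt_eq_rpow]
    _ ≤ (2 * Real.pi * d ^ 2) ^ (1 : ℝ) * (Real.exp 1 * √p) := by
        gcongr
        · linarith
        · exact rpow_one_div_self_le_exp_one hp0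
    _ = _ := by rw [Real.rpow_one]; ring

/-- The critical Sobolev–Poincaré inequality with the sharp growth `√p` of the constant. -/
theorem measure_mul_lintegral_rpow_le {Ω : Set Plane} (hΩ : IsOpen Ω)
    (hconv : Convex ℝ Ω) {d : ℝ} (hd : 1 ≤ d) (hdist : ∀ x ∈ Ω, ∀ y ∈ Ω, dist x y < d)
    (hfin : volume Ω ≠ ⊤) {w : Plane → ℝ} (hw : IntegrableOn w Ω) {D : Fin 2 → Plane → ℝ}
    (hD : IsWeakGradientScalar Ω w D) {g : Plane → ℝ≥0∞} (hgm : Measurable g)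
    (hg : ∀ i, ∀ᵐ y ∂volume.restrict Ω, ‖D i y‖ₑ ≤ g y) {p : ℝ} (hp : 4 ≤ p) :
    volume Ω * (∫⁻ x in Ω, ‖w x‖ₑ ^ p) ^ (1 / p) ≤
      2 * (ENNReal.ofReal (2 * Real.pi * d ^ 4 * Real.exp 1 * √p) *
        (∫⁻ z, g z ^ (2 : ℝ)) ^ (1 / 2 : ℝ) + ‖∫ x in Ω, w x‖ₑ * (1 + volume Ω)) := by
  have hp0 : 0 < p := by linarith
  have hpi : 0 ≤ 1 / p := by positivity
  set m := volume Ω with hm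
  set c := ‖∫ x in Ω, w x‖ₑ with hc
  set F : Plane → ℝ≥0∞ := fun x => ∫⁻ y in Ω, ‖w y - w x‖ₑ with hF
  -- `|Ω| w(x)` is the integral of `w` minus the integral of `w(y) - w(x)` over `y`
  have hpt : ∀ x, m * ‖w x‖ₑ ≤ F x + c := by
    intro x
    have hfin' : IsFiniteMeasure (volume.restrict Ω) :=
      ⟨by rw [Measure.restrict_apply_univ]; exact hfin.lt_top⟩
    have h1 : ∫ y in Ω, (w y - w x) = (∫ y in Ω, w y) - (volume Ω).toReal * w x := by
      rw [integral_sub hw (integrable_const _), setIntegral_const, smul_eq_mul, Measure.real]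
    have h2 : m * ‖w x‖ₑ = ‖(∫ y in Ω, w y) - ∫ y in Ω, (w y - w x)‖ₑ := by
      rw [h1, sub_sub_cancel, enorm_mul, Real.enorm_of_nonneg ENNReal.toReal_nonneg,
        ENNReal.ofReal_toReal hfin]
    rw [h2, add_comm]
    refine enorm_sub_le.trans ?_
    gcongr
    exact enorm_integral_le_lintegral_enorm _
  have hosc : (∫⁻ x in Ω, F x ^ p) ^ (1 / p) ≤
      ENNReal.ofReal (2 * Real.pi * d ^ 4 * Real.exp 1 * √p) *
        (∫⁻ z, g z ^ (2 : ℝ)) ^ (1 / 2 : ℝ) := by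
    refine (ENNReal.rpow_le_rpow (lintegral_oscillation_le hΩ hconv (by linarith) hdist hw hD hgm hg
      (by linarith)) hpi).trans ?_
    rw [ENNReal.mul_rpow_of_nonneg _ _ hpi, ENNReal.mul_rpow_of_nonneg _ _ hpi,
      ← ENNReal.rpow_mul, ← ENNReal.rpow_mul, ← ENNReal.rpow_mul]
    have e1 : p * (1 / p) = 1 := by field_simp
    have e2 : p / 2 * (1 / p) = 1 / 2 := by field_simp
    have e3 : (1 + p / 2) * (1 / p) = 1 / p + 1 / 2 := by field_simp
    rw [e1, e2, e3, ENNReal.rpow_one]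
    calc _ ≤ ENNReal.ofReal (d ^ 2) * ((∫⁻ z, g z ^ (2 : ℝ)) ^ (1 / 2 : ℝ) *
          ENNReal.ofReal (2 * Real.pi * d ^ 2 * Real.exp 1 * √p)) := by
          gcongr
          exact lintegral_rieszKernel_rpow_le_sqrt hd hp
      _ = (ENNReal.ofReal (d ^ 2) * ENNReal.ofReal (2 * Real.pi * d ^ 2 * Real.exp 1 * √p)) *
          (∫⁻ z, g z ^ (2 : ℝ)) ^ (1 / 2 : ℝ) := by ring
      _ = _ := by
          rw [← ENNReal.ofReal_mul (by positivity)]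
          congr 2
          ring
  have hmp : m ^ (1 / p) ≤ 1 + m := by
    rcases le_total m 1 with h | h
    · exact (ENNReal.rpow_le_one h hpi).trans le_self_add
    · calc m ^ (1 / p) ≤ m ^ (1 : ℝ) := ENNReal.rpow_le_rpow_of_exponent_le h
            ((div_le_one hp0).2 (by linarith))
        _ ≤ 1 + m := by rw [ENNReal.rpow_one]; exact le_add_self
  calc m * (∫⁻ x in Ω, ‖w x‖ₑ ^ p) ^ (1 / p)
      = (∫⁻ x in Ω, (m * ‖w x‖ₑ) ^ p) ^ (1 / p) := by
        simp_rw [ENNReal.mul_rpow_of_nonneg _ _ hp0.le]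
        rw [lintegral_const_mul' _ _ (ENNReal.rpow_ne_top_of_nonneg hp0.le hfin),
          ENNReal.mul_rpow_of_nonneg _ _ hpi, ← ENNReal.rpow_mul, mul_one_div_cancel hp0.ne',
          ENNReal.rpow_one]
    _ ≤ (∫⁻ x in Ω, 2 ^ p * (F x ^ p + c ^ p)) ^ (1 / p) := by
        refine ENNReal.rpow_le_rpow (lintegral_mono fun x => ?_) hpi
        refine (ENNReal.rpow_le_rpow (hpt x) hp0.le).trans ?_
        refine (ENNReal.rpow_add_le_mul_rpow_add_rpow _ _ (by linarith)).trans ?_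
        gcongr
        · norm_num
        · linarith
    _ = 2 * (∫⁻ x in Ω, F x ^ p + c ^ p) ^ (1 / p) := by
        rw [lintegral_const_mul' _ _ (by simp),
          ENNReal.mul_rpow_of_nonneg _ _ hpi, ← ENNReal.rpow_mul, mul_one_div_cancel hp0.ne',
          ENNReal.rpow_one]
    _ = 2 * ((∫⁻ x in Ω, F x ^ p) + c ^ p * m) ^ (1 / p) := by
        rw [lintegral_add_right _ measurable_const, lintegral_const, Measure.restrict_apply_univ]
    _ ≤ 2 * ((∫⁻ x in Ω, F x ^ p) ^ (1 / p) + c * m ^ (1 / p)) := by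
        gcongr
        refine (ENNReal.rpow_add_le_add_rpow _ _ hpi ((div_le_one hp0).2 (by linarith))).trans ?_
        rw [ENNReal.mul_rpow_of_nonneg _ _ hpi, ← ENNReal.rpow_mul, mul_one_div_cancel hp0.ne',
          ENNReal.rpow_one]
    _ ≤ _ := by gcongr

theorem IsH1With.isWeakGradientScalar {Ω : Set Plane} {u : Plane → Plane}
    {Du : Plane → EuclideanSpace ℝ (Fin 2 × Fin 2)} (h : IsH1With Ω u Du) (j : Fin 2) :
    IsWeakGradientScalar Ω (fun x => u x j) fun i x => Du x (i, j) :=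
  fun φ h1 h2 h3 i => h.weakGradient φ h1 h2 h3 i j

/-! ### Vector fields with zero normal trace or zero mean -/

/-- The mean of the field is controlled by its gradient. For zero normal trace, Green's formula with
the coordinate `x ↦ x j` as test function expresses `∫_Ω uʲ` through the divergence of `u`. -/
theorem enorm_integral_coord_le {Ω : Set Plane} (hΩ : MeasurableSet Ω) {R : ℝ} (hR0 : 0 ≤ R)
    (hR : ∀ x ∈ Ω, ‖x‖ ≤ R) (hfin : volume Ω ≠ ⊤) {u : Plane → Plane}
    {Du : Plane → EuclideanSpace ℝ (Fin 2 × Fin 2)} (h : IsH1With Ω u Du)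
    (hu : HasZeroNormalTrace Ω u Du ∨ ∫ x in Ω, u x = 0) (j : Fin 2) :
    ‖∫ x in Ω, u x j‖ₑ ≤ ENNReal.ofReal (2 * R) * volume Ω ^ (1 / 2 : ℝ) *
      eLpNorm Du 2 (volume.restrict Ω) := by
  have hfin' : IsFiniteMeasure (volume.restrict Ω) :=
    ⟨by rw [Measure.restrict_apply_univ]; exact hfin.lt_top⟩
  have hui : Integrable u (volume.restrict Ω) := h.memLp.integrable one_le_two
  have hDi : Integrable Du (volume.restrict Ω) := h.memLp_grad.integrable one_le_two
  have huj : Integrable (fun x => u x j) (volume.restrict Ω) :=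
    (EuclideanSpace.proj (𝕜 := ℝ) j).integrable_comp hui
  rcases hu with hu | hu
  · have hDij : ∀ q, Integrable (fun x => Du x q) (volume.restrict Ω) := fun q =>
      (EuclideanSpace.proj (𝕜 := ℝ) q).integrable_comp hDi
    set S : Plane → ℝ := fun x => x j * ∑ i : Fin 2, Du x (i, i) with hS
    have hbd : ∀ x ∈ Ω, ‖S x‖ ≤ 2 * R * ‖Du x‖ := by
      intro x hx
      have h1 : ‖x j‖ ≤ R := (PiLp.norm_apply_le x j).trans (hR x hx)
      have h2 : ‖∑ i : Fin 2, Du x (i, i)‖ ≤ 2 * ‖Du x‖ := by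
        rw [Fin.sum_univ_two]
        refine (norm_add_le _ _).trans ?_
        have := PiLp.norm_apply_le (Du x) (0, 0)
        have := PiLp.norm_apply_le (Du x) (1, 1)
        linarith
      rw [hS, norm_mul]
      calc _ ≤ R * (2 * ‖Du x‖) := by gcongr
        _ = _ := by ring
    have hSi : Integrable S (volume.restrict Ω) := by
      refine (hDi.norm.const_mul (2 * R)).mono' ?_ ?_
      · refine AEStronglyMeasurable.mul
          (EuclideanSpace.proj (𝕜 := ℝ) j).continuous.aestronglyMeasurable ?_
        simp only [Fin.sum_univ_two]
        exact (hDij _).1.add (hDij _).1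
      · filter_upwards [ae_restrict_mem hΩ] with x hx using hbd x hx
    have hgreen := hu (EuclideanSpace.proj (𝕜 := ℝ) j) (ContinuousLinearMap.contDiff _)
    simp only [ContinuousLinearMap.fderiv] at hgreen
    change ∫ x in Ω, (u x j + S x) = 0 at hgreen
    rw [integral_add huj hSi] at hgreen
    rw [eq_neg_of_add_eq_zero_left hgreen, enorm_neg]
    calc ‖∫ x in Ω, S x‖ₑ ≤ ∫⁻ x in Ω, ‖S x‖ₑ := enorm_integral_le_lintegral_enorm _
      _ ≤ ∫⁻ x in Ω, ENNReal.ofReal (2 * R) * ‖Du x‖ₑ := by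
          refine setLIntegral_mono' hΩ fun x hx => ?_
          rw [← ofReal_norm, ← ofReal_norm, ← ENNReal.ofReal_mul (by positivity)]
          exact ENNReal.ofReal_le_ofReal (hbd x hx)
      _ = ENNReal.ofReal (2 * R) * eLpNorm Du 1 (volume.restrict Ω) := by
          rw [lintegral_const_mul' _ _ ENNReal.ofReal_ne_top, eLpNorm_one_eq_lintegral_enorm]
      _ ≤ ENNReal.ofReal (2 * R) * (eLpNorm Du 2 (volume.restrict Ω) *
            volume Ω ^ (1 / 2 : ℝ)) := by
          gcongr
          have h1 := eLpNorm_le_eLpNorm_mul_rpow_measure_univ (p := 1) (q := 2) one_le_two hDi.1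
          rw [Measure.restrict_apply_univ] at h1
          norm_num at h1 ⊢
          exact h1
      _ = _ := by ring
  · have h1 := (EuclideanSpace.proj (𝕜 := ℝ) j).integral_comp_comm hui
    change ∫ x in Ω, u x j = (∫ x in Ω, u x) j at h1
    rw [h1, hu]
    simp

/-- `‖u‖_p ≤ K √p ‖∇u‖_2` for `H¹` fields with zero normal trace or zero mean, uniformly in `p`. -/
theorem exists_eLpNorm_le_sqrt_mul_eLpNorm_grad {Ω : Set Plane} (hΩ : IsSmoothConvexDomain Ω) :
    ∃ K : ℝ, 1 ≤ K ∧ ∀ (u : Plane → Plane) (Du : Plane → EuclideanSpace ℝ (Fin 2 × Fin 2)),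
      IsH1With Ω u Du → (HasZeroNormalTrace Ω u Du ∨ ∫ x in Ω, u x = 0) →
      ∀ p : ℝ, 4 ≤ p → (∫⁻ x in Ω, ‖u x‖ₑ ^ p) ^ (1 / p) ≤
        ENNReal.ofReal (K * √p) * eLpNorm Du 2 (volume.restrict Ω) := by
  obtain ⟨R, hR0, hR⟩ := hΩ.bounded.exists_pos_norm_le
  set d : ℝ := 2 * R + 1 with hd
  have hd1 : 1 ≤ d := by linarith
  have hdist : ∀ x ∈ Ω, ∀ y ∈ Ω, dist x y < d := fun x hx y hy => by
    have := dist_le_norm_add_norm x y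
    have := hR x hx
    have := hR y hy
    linarith
  have hfin : volume Ω ≠ ⊤ := hΩ.bounded.measure_lt_top.ne
  have hpos : volume Ω ≠ 0 := (hΩ.isOpen.measure_pos volume hΩ.nonempty).ne'
  have hΩm := hΩ.isOpen.measurableSet
  set m := volume Ω with hm
  set A : ℝ≥0∞ := ENNReal.ofReal (2 * Real.pi * d ^ 4 * Real.exp 1) +
    ENNReal.ofReal (2 * R) * m ^ (1 / 2 : ℝ) * (1 + m) with hA
  set B : ℝ≥0∞ := 2 * (m⁻¹ * (2 * A)) with hB
  have hBfin : B ≠ ⊤ := by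
    have : m ^ (1 / 2 : ℝ) ≠ ⊤ := ENNReal.rpow_ne_top_of_nonneg (by norm_num) hfin
    have h2 : m⁻¹ ≠ ⊤ := ENNReal.inv_ne_top.2 hpos
    have hAfin : A ≠ ⊤ := by
      rw [hA]
      exact ENNReal.add_ne_top.2 ⟨ENNReal.ofReal_ne_top, ENNReal.mul_ne_top
        (ENNReal.mul_ne_top ENNReal.ofReal_ne_top this)
        (ENNReal.add_ne_top.2 ⟨ENNReal.one_ne_top, hfin⟩)⟩
    exact ENNReal.mul_ne_top (by simp) (ENNReal.mul_ne_top h2 (ENNReal.mul_ne_top (by simp) hAfin))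
  refine ⟨1 + B.toReal, by linarith [ENNReal.toReal_nonneg (a := B)], ?_⟩
  intro u Du h hu p hp
  have hfin' : IsFiniteMeasure (volume.restrict Ω) :=
    ⟨by rw [Measure.restrict_apply_univ]; exact hfin.lt_top⟩
  have hp0 : 0 < p := by linarith
  have hs1 : 1 ≤ √p := Real.one_le_sqrt.2 (by linarith)
  set N := eLpNorm Du 2 (volume.restrict Ω) with hN
  have hui : Integrable u (volume.restrict Ω) := h.memLp.integrable one_le_two
  have huj : ∀ j, Integrable (fun x => u x j) (volume.restrict Ω) := fun j =>
    (EuclideanSpace.proj (𝕜 := ℝ) j).integrable_comp hui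
  obtain ⟨D, hDm, hDae⟩ := h.memLp_grad.1
  set g : Plane → ℝ≥0∞ := Ω.indicator fun x => ‖D x‖ₑ with hg
  have hgm : Measurable g :=
    hDm.measurable.enorm.indicator hΩm
  have hgD : ∀ i j, ∀ᵐ y ∂volume.restrict Ω, ‖Du y (i, j)‖ₑ ≤ g y := by
    intro i j
    filter_upwards [hDae, ae_restrict_mem hΩm] with y hy hyΩ
    rw [hg, Set.indicator_of_mem hyΩ, ← hy, enorm_le_iff_norm_le]
    exact PiLp.norm_apply_le (Du y) (i, j)
  have hgN : (∫⁻ z, g z ^ (2 : ℝ)) ^ (1 / 2 : ℝ) = N := by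
    have h1 : ∀ z, g z ^ (2 : ℝ) = Ω.indicator (fun x => ‖D x‖ₑ ^ (2 : ℝ)) z := by
      intro z
      by_cases hz : z ∈ Ω <;> simp [hg, hz]
    simp_rw [h1]
    rw [lintegral_indicator hΩm, hN, eLpNorm_eq_lintegral_rpow_enorm_toReal (by simp) (by simp)]
    simp only [ENNReal.toReal_ofNat]
    congr 1
    refine lintegral_congr_ae ?_
    filter_upwards [hDae] with z hz
    rw [← hz]
  have hj : ∀ j : Fin 2, (∫⁻ x in Ω, ‖u x j‖ₑ ^ p) ^ (1 / p) ≤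
      m⁻¹ * (2 * A) * (ENNReal.ofReal (√p) * N) := by
    intro j
    have h1 := measure_mul_lintegral_rpow_le hΩ.isOpen hΩ.convex hd1 hdist hfin (huj j)
      (h.isWeakGradientScalar j) hgm (fun i => hgD i j) hp
    rw [hgN] at h1
    have h2 := enorm_integral_coord_le hΩm hR0.le hR hfin h hu j
    rw [mul_assoc, ← one_mul (_ ^ (1 / p)), ← ENNReal.inv_mul_cancel hpos hfin, mul_assoc]
    gcongr m⁻¹ * ?_
    refine h1.trans ?_
    rw [mul_assoc 2 A]
    gcongr 2 * ?_
    have h3 : (1 : ℝ≥0∞) ≤ ENNReal.ofReal (√p) := by simpa using hs1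
    calc _ ≤ ENNReal.ofReal (2 * Real.pi * d ^ 4 * Real.exp 1 * √p) * N +
          (ENNReal.ofReal (2 * R) * m ^ (1 / 2 : ℝ) * N) * (1 + m) * 1 := by
          rw [mul_one]; gcongr
      _ ≤ ENNReal.ofReal (2 * Real.pi * d ^ 4 * Real.exp 1 * √p) * N +
          (ENNReal.ofReal (2 * R) * m ^ (1 / 2 : ℝ) * N) * (1 + m) * ENNReal.ofReal (√p) := by
          gcongr
      _ = _ := by
          rw [ENNReal.ofReal_mul (by positivity), hA]
          ring
  have hsum : (∫⁻ x in Ω, ‖u x‖ₑ ^ p) ^ (1 / p) ≤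
      (∫⁻ x in Ω, ‖u x 0‖ₑ ^ p) ^ (1 / p) + (∫⁻ x in Ω, ‖u x 1‖ₑ ^ p) ^ (1 / p) := by
    refine le_trans ?_ (ENNReal.lintegral_Lp_add_le (huj 0).1.enorm (huj 1).1.enorm
      (by linarith))
    refine ENNReal.rpow_le_rpow (lintegral_mono fun x => ENNReal.rpow_le_rpow ?_ hp0.le)
      (by positivity)
    have hx : u x = u x 0 • EuclideanSpace.single 0 (1 : ℝ) +
        u x 1 • EuclideanSpace.single 1 (1 : ℝ) := by
      ext j; fin_cases j <;> simp
    calc ‖u x‖ₑ ≤ ‖u x 0 • EuclideanSpace.single (0 : Fin 2) (1 : ℝ)‖ₑ +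
          ‖u x 1 • EuclideanSpace.single (1 : Fin 2) (1 : ℝ)‖ₑ := by
          conv_lhs => rw [hx]
          exact enorm_add_le _ _
      _ = _ := by simp [norm_smul, ← ofReal_norm]
  calc _ ≤ m⁻¹ * (2 * A) * (ENNReal.ofReal (√p) * N) +
        m⁻¹ * (2 * A) * (ENNReal.ofReal (√p) * N) := hsum.trans (add_le_add (hj 0) (hj 1))
    _ = B * ENNReal.ofReal (√p) * N := by rw [hB]; ring
    _ = ENNReal.ofReal (B.toReal * √p) * N := by
        rw [ENNReal.ofReal_mul ENNReal.toReal_nonneg, ENNReal.ofReal_toReal hBfin]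
    _ ≤ _ := by
        gcongr
        linarith

/-! ### Interpolation and the choice of the exponent -/

/-- Interpolation of `L⁴` between `L²` and `L^p`. -/
theorem eLpNorm_four_sq_le {α F : Type*} [MeasurableSpace α] [NormedAddCommGroup F]
    {μ : Measure α} {f : α → F} (hf : AEStronglyMeasurable f μ) {p : ℝ} (hp : 4 ≤ p) :
    eLpNorm f 4 μ ^ 2 ≤ eLpNorm f 2 μ ^ (1 - 2 / (p - 2)) *
      ((∫⁻ x, ‖f x‖ₑ ^ p ∂μ) ^ (1 / p)) ^ (1 + 2 / (p - 2)) := by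
  have hp2 : 0 < p - 2 := by linarith
  have hp0 : 0 < p := by linarith
  have hε0 : 0 ≤ 2 / (p - 2) := by positivity
  have hε1 : 0 ≤ 1 - 2 / (p - 2) := by rw [sub_nonneg, div_le_one hp2]; linarith
  have holder := ENNReal.lintegral_mul_norm_pow_le (μ := μ) (hf.enorm.pow_const (2 : ℝ))
    (hf.enorm.pow_const p) hε1 hε0 (by ring)
  have hexp : 2 * (1 - 2 / (p - 2)) + p * (2 / (p - 2)) = 4 := by field_simp; ring
  have hint : ∀ x, (‖f x‖ₑ ^ (2 : ℝ)) ^ (1 - 2 / (p - 2)) * (‖f x‖ₑ ^ p) ^ (2 / (p - 2)) =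
      ‖f x‖ₑ ^ (4 : ℝ) := by
    intro x
    rw [← ENNReal.rpow_mul, ← ENNReal.rpow_mul,
      ← ENNReal.rpow_add_of_nonneg _ _ (by positivity) (by positivity), hexp]
  simp_rw [hint] at holder
  rw [eLpNorm_eq_lintegral_rpow_enorm_toReal (by simp) (by simp),
    eLpNorm_eq_lintegral_rpow_enorm_toReal (by simp) (by simp)]
  simp only [ENNReal.toReal_ofNat]
  rw [← ENNReal.rpow_natCast, ← ENNReal.rpow_mul, ← ENNReal.rpow_mul, ← ENNReal.rpow_mul]
  have e1 : 1 / (4 : ℝ) * ((2 : ℕ) : ℝ) = 1 / 2 := by norm_num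
  have e2 : 1 / p * (1 + 2 / (p - 2)) = 2 / (p - 2) * (1 / 2) := by field_simp; ring
  rw [e1, e2, mul_comm (1 / 2 : ℝ), ENNReal.rpow_mul, ENNReal.rpow_mul,
    ← ENNReal.mul_rpow_of_nonneg _ _ (by norm_num)]
  exact ENNReal.rpow_le_rpow holder (by norm_num)

/-- If `y ≤ e^(p/2)` then the power `y ^ (2/(p-2))` left over from interpolation is bounded. -/
theorem rpow_two_div_le {p y : ℝ} (hp : 4 ≤ p) (hy0 : 0 ≤ y) (hy : y ≤ Real.exp (p / 2)) :
    y ^ (2 / (p - 2)) ≤ Real.exp 2 := by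
  have hp2 : 0 < p - 2 := by linarith
  refine (Real.rpow_le_rpow hy0 hy (by positivity)).trans ?_
  rw [← Real.exp_mul]
  refine Real.exp_le_exp.2 ?_
  rw [div_mul_div_comm, div_le_iff₀ (by linarith)]
  linarith

/-- The choice `p = 4 + log (2 + G²)` balances the growth `√p` of the Sobolev constant against the
surplus power `G ^ (2/(p-2))`, which it renders bounded. -/
theorem interpolation_bound_le {s G L p : ℝ} (hs : 0 ≤ s) (hG : 0 ≤ G) (hL : 1 ≤ L)
    (hp : p = 4 + Real.log (2 + G ^ 2)) :
    s ^ (1 - 2 / (p - 2)) * (L * √p * G) ^ (1 + 2 / (p - 2)) ≤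
      3 * Real.exp 2 ^ 2 * L ^ 2 * (1 + s) * G * √(Real.log (2 + G ^ 2)) := by
  have hlog2 : 1 / 2 ≤ Real.log (2 + G ^ 2) := by
    have h1 := Real.log_two_gt_d9
    have h2 : Real.log 2 ≤ Real.log (2 + G ^ 2) :=
      Real.log_le_log (by norm_num) (by linarith [sq_nonneg G])
    linarith
  have hp4 : 4 ≤ p := by linarith
  have hp2 : 0 < p - 2 := by linarith
  have hε0 : 0 ≤ 2 / (p - 2) := by positivity
  have hε1 : 2 / (p - 2) ≤ 1 := by rw [div_le_one hp2]; linarith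
  set ε := 2 / (p - 2) with hε
  have hs1 : s ^ (1 - ε) ≤ 1 + s := by
    calc s ^ (1 - ε) ≤ (1 + s) ^ (1 - ε) := Real.rpow_le_rpow hs (by linarith) (by linarith)
      _ ≤ (1 + s) ^ (1 : ℝ) := Real.rpow_le_rpow_of_exponent_le (by linarith) (by linarith)
      _ = 1 + s := Real.rpow_one _
  have hL1 : L ^ (1 + ε) ≤ L ^ 2 := by
    rw [← Real.rpow_natCast L 2]
    exact Real.rpow_le_rpow_of_exponent_le hL (by push_cast; linarith)
  have hexp : Real.exp (p / 2) ^ 2 = Real.exp p := by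
    rw [← Real.exp_nat_mul]; congr 1; push_cast; ring
  have hsplit : ∀ y : ℝ, 0 ≤ y → y ≤ Real.exp (p / 2) → y ^ (1 + ε) ≤ y * Real.exp 2 := by
    intro y hy0 hy
    rw [Real.rpow_add_of_nonneg hy0 zero_le_one hε0, Real.rpow_one]
    exact mul_le_mul_of_nonneg_left (rpow_two_div_le hp4 hy0 hy) hy0
  have hp1 : √p ^ (1 + ε) ≤ √p * Real.exp 2 := by
    refine hsplit _ (Real.sqrt_nonneg p) (Real.sqrt_le_iff.2 ⟨(Real.exp_pos _).le, ?_⟩)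
    rw [hexp]
    linarith [Real.add_one_le_exp p]
  have hG1 : G ^ (1 + ε) ≤ G * Real.exp 2 := by
    refine hsplit _ hG (abs_le_of_sq_le_sq' ?_ (Real.exp_pos _).le).2
    rw [hexp]
    calc G ^ 2 ≤ 2 + G ^ 2 := by linarith
      _ = Real.exp (Real.log (2 + G ^ 2)) := (Real.exp_log (by positivity)).symm
      _ ≤ Real.exp p := Real.exp_le_exp.2 (by linarith)
  have hsq : √p ≤ 3 * √(Real.log (2 + G ^ 2)) := by
    rw [show (3 : ℝ) = √9 by rw [show (9 : ℝ) = 3 ^ 2 by norm_num]; simp,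
      ← Real.sqrt_mul (by norm_num)]
    exact Real.sqrt_le_sqrt (by linarith)
  calc s ^ (1 - ε) * (L * √p * G) ^ (1 + ε)
      = s ^ (1 - ε) * (L ^ (1 + ε) * √p ^ (1 + ε) * G ^ (1 + ε)) := by
        rw [Real.mul_rpow (by positivity) hG, Real.mul_rpow (by linarith) (Real.sqrt_nonneg p)]
    _ ≤ (1 + s) * (L ^ 2 * (√p * Real.exp 2) * (G * Real.exp 2)) := by gcongr
    _ ≤ (1 + s) * (L ^ 2 * (3 * √(Real.log (2 + G ^ 2)) * Real.exp 2) * (G * Real.exp 2)) := by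
        gcongr
    _ = _ := by ring

theorem lemma2p3 (Ω : Set Plane) (hΩ : IsSmoothConvexDomain Ω) (ρhat : ℝ) :
    ∃ C : ℝ, 0 < C ∧
      ∀ (ρ : Plane → ℝ) (u : Plane → Plane) (Du : Plane → EuclideanSpace ℝ (Fin 2 × Fin 2)),
        AEStronglyMeasurable ρ (volume.restrict Ω) →
        (∀ᵐ x ∂(volume.restrict Ω), 0 ≤ ρ x ∧ ρ x ≤ ρhat) →
        IsH1With Ω u Du →
        (HasZeroNormalTrace Ω u Du ∨ ∫ x in Ω, u x = 0) →
        MemLp (fun x => √(ρ x) • u x) 4 (volume.restrict Ω) ∧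
        normLp Ω 4 (fun x => √(ρ x) • u x) ^ 2 ≤
          C * (1 + normLp Ω 2 (fun x => √(ρ x) • u x)) * normLp Ω 2 Du *
            √(Real.log (2 + normLp Ω 2 Du ^ 2)) := by
  obtain ⟨K, hK1, hK⟩ := exists_eLpNorm_le_sqrt_mul_eLpNorm_grad hΩ
  set L : ℝ := (1 + √ρhat) * K with hL
  have hL1 : 1 ≤ L := one_le_mul_of_one_le_of_one_le (by linarith [Real.sqrt_nonneg ρhat]) hK1
  refine ⟨3 * Real.exp 2 ^ 2 * L ^ 2, by positivity, ?_⟩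
  intro ρ u Du hρm hρ h hu
  set f : Plane → Plane := fun x => √(ρ x) • u x with hf
  set N := eLpNorm Du 2 (volume.restrict Ω) with hN
  have hNfin : N ≠ ⊤ := h.memLp_grad.2.ne
  have hfm : AEStronglyMeasurable f (volume.restrict Ω) :=
    (Real.continuous_sqrt.comp_aestronglyMeasurable hρm).smul h.memLp.1
  have hfu : ∀ᵐ x ∂(volume.restrict Ω), ‖f x‖ ≤ √ρhat * ‖u x‖ := by
    filter_upwards [hρ] with x hx
    rw [hf, norm_smul, Real.norm_of_nonneg (Real.sqrt_nonneg _)]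
    gcongr
    exact hx.2
  have hf2 : MemLp f 2 (volume.restrict Ω) := h.memLp.of_le_mul hfm hfu
  set G := normLp Ω 2 Du with hG
  set s := normLp Ω 2 f with hs
  have hG0 : 0 ≤ G := ENNReal.toReal_nonneg
  have hs0 : 0 ≤ s := ENNReal.toReal_nonneg
  have hGN : N = ENNReal.ofReal G := (ENNReal.ofReal_toReal hNfin).symm
  have hsN : eLpNorm f 2 (volume.restrict Ω) = ENNReal.ofReal s :=
    (ENNReal.ofReal_toReal hf2.2.ne).symm
  set p : ℝ := 4 + Real.log (2 + G ^ 2) with hp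
  have hp4 : 4 ≤ p := by
    have : 0 ≤ Real.log (2 + G ^ 2) := Real.log_nonneg (by linarith [sq_nonneg G])
    linarith
  have hp0 : 0 < p := by linarith
  have hp2 : 0 < p - 2 := by linarith
  have hfp : (∫⁻ x in Ω, ‖f x‖ₑ ^ p) ^ (1 / p) ≤ ENNReal.ofReal (L * √p * G) := by
    calc (∫⁻ x in Ω, ‖f x‖ₑ ^ p) ^ (1 / p)
        ≤ (∫⁻ x in Ω, ENNReal.ofReal (√ρhat) ^ p * ‖u x‖ₑ ^ p) ^ (1 / p) := by
          refine ENNReal.rpow_le_rpow (lintegral_mono_ae ?_) (by positivity)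
          filter_upwards [hfu] with x hx
          rw [← ENNReal.mul_rpow_of_nonneg _ _ hp0.le, ← ofReal_norm, ← ofReal_norm,
            ← ENNReal.ofReal_mul (Real.sqrt_nonneg _)]
          exact ENNReal.rpow_le_rpow (ENNReal.ofReal_le_ofReal hx) hp0.le
      _ = ENNReal.ofReal (√ρhat) * (∫⁻ x in Ω, ‖u x‖ₑ ^ p) ^ (1 / p) := by
          rw [lintegral_const_mul' _ _ (ENNReal.rpow_ne_top_of_nonneg hp0.le
            ENNReal.ofReal_ne_top), ENNReal.mul_rpow_of_nonneg _ _ (by positivity),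
            ← ENNReal.rpow_mul, mul_one_div_cancel hp0.ne', ENNReal.rpow_one]
      _ ≤ ENNReal.ofReal (1 + √ρhat) * (ENNReal.ofReal (K * √p) * N) := by
          gcongr
          · linarith
          · exact hK u Du h hu p hp4
      _ = ENNReal.ofReal (L * √p * G) := by
          rw [hGN, ← ENNReal.ofReal_mul (by positivity), ← ENNReal.ofReal_mul (by positivity), hL]
          congr 1
          ring
  have hε1 : 0 ≤ 1 - 2 / (p - 2) := by rw [sub_nonneg, div_le_one hp2]; linarith
  -- `key` is an inequality in `[0, ∞]`, so it also gives that the `L⁴` norm is finite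
  have key : eLpNorm f 4 (volume.restrict Ω) ^ 2 ≤
      ENNReal.ofReal (3 * Real.exp 2 ^ 2 * L ^ 2 * (1 + s) * G * √(Real.log (2 + G ^ 2))) := by
    calc eLpNorm f 4 (volume.restrict Ω) ^ 2
        ≤ ENNReal.ofReal s ^ (1 - 2 / (p - 2)) *
            ENNReal.ofReal (L * √p * G) ^ (1 + 2 / (p - 2)) := by
          refine (eLpNorm_four_sq_le hfm hp4).trans ?_
          rw [hsN]
          gcongr
      _ = ENNReal.ofReal (s ^ (1 - 2 / (p - 2)) * (L * √p * G) ^ (1 + 2 / (p - 2))) := by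
          rw [ENNReal.ofReal_rpow_of_nonneg hs0 hε1,
            ENNReal.ofReal_rpow_of_nonneg (by positivity) (by positivity),
            ← ENNReal.ofReal_mul (by positivity)]
      _ ≤ _ := ENNReal.ofReal_le_ofReal (interpolation_bound_le hs0 hG0 hL1 hp)
  have hfin : eLpNorm f 4 (volume.restrict Ω) < ⊤ := by
    by_contra! htop
    rw [top_le_iff.1 htop] at key
    simp at key
  refine ⟨⟨hfm, hfin⟩, ?_⟩
  rw [normLp, ← ENNReal.toReal_pow]
  exact ENNReal.toReal_le_of_le_ofReal (by positivity) key
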